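/- An algebra (not necessarily associative or unital) over a field $k$ is called bicommutative if it satisfies the identities $x(yz)=y(xz)$ and $(xy)z=(xz)y$. Let $BC(X)$ denote the free bicommutative algebra over $k$ generated by a set $X$, and for $S\subseteq BC(X)$ let $BC(X\mid S)=BC(X)/\mathrm{Id}(S)$, where $\mathrm{Id}(S)$ is the two-sided ideal of $BC(X)$ generated by $S$. Let $k$ be an arbitrary field, let $X=\{x_1,\dots,x_n\}$ and $S\subseteq BC(X)$ be finite, and let $F$ be any computable field of coefficients contained in $k$ (that is, the elements of $F$ are coded by natural numbers in such a way that addition, negation, multiplication and inversion are computable; for example $F$ may be the prime field of $k$, or $F=k$ if $k$ itself is a computable field). Then the word problem of the finitely presented bicommutative algebra $BC(X\mid S)$ is solvable: there is an algorithm which, given two formal finite linear combinations $\sum_i a_i t_i$ and $\sum_j b_j u_j$ with coefficients $a_i,b_j\in F$ and with $t_i,u_j$ nonassociative words (bracketed words) in $x_1,\dots,x_n$, decides whether they represent the same element of $BC(X\mid S)$. -/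

import Mathlib

/-! ### Bicommutative algebras

A (not necessarily associative, not necessarily unital) algebra over `k` is given by
`[NonUnitalNonAssocRing A] [Module k A] [IsScalarTower k A A] [SMulCommClass k A A]`. -/

/-- The identities `x(yz) = y(xz)` and `(xy)z = (xz)y`. -/
class IsBicommutative (A : Type*) [Mul A] : Prop where
  left_comm : ∀ x y z : A, x * (y * z) = y * (x * z)
  right_comm : ∀ x y z : A, (x * y) * z = (x * z) * y

section Ideals

variable (k : Type*) [Field k] {A : Type*} [NonUnitalNonAssocRing A] [Module k A]

/-- A linear subspace is a (two-sided) ideal of the algebra `A` if it absorbs products with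
arbitrary elements of `A` on either side. -/
def IsAlgIdeal {k A : Type*} [Field k] [NonUnitalNonAssocRing A] [Module k A]
    (I : Submodule k A) : Prop :=
  ∀ a x : A, x ∈ I → a * x ∈ I ∧ x * a ∈ I

/-- `Id(S)`: the ideal of the algebra `A` generated by the set `S`. -/
def idealGen (S : Set A) : Submodule k A :=
  sInf {I : Submodule k A | S ⊆ I ∧ IsAlgIdeal I}

theorem subset_idealGen (S : Set A) : S ⊆ idealGen k S := by
  intro s hs
  simp only [idealGen, SetLike.mem_coe, Submodule.mem_sInf]
  exact fun I hI => hI.1 hs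

theorem isAlgIdeal_idealGen (S : Set A) : IsAlgIdeal (idealGen k S) := by
  intro a x hx
  simp only [idealGen, Submodule.mem_sInf] at hx ⊢
  exact ⟨fun I hI => (hI.2 a x (hx I hI)).1, fun I hI => (hI.2 a x (hx I hI)).2⟩

theorem idealGen_le {S : Set A} {I : Submodule k A} (hS : S ⊆ I) (hI : IsAlgIdeal I) :
    idealGen k S ≤ I :=
  sInf_le ⟨hS, hI⟩

/-- The quotient algebra `A / Id(S)`. -/
def QuotAlg (S : Set A) : Type _ := A ⧸ idealGen k S

namespace QuotAlg

variable (S : Set A)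

instance : AddCommGroup (QuotAlg k S) := inferInstanceAs (AddCommGroup (A ⧸ idealGen k S))

instance : Module k (QuotAlg k S) := inferInstanceAs (Module k (A ⧸ idealGen k S))

/-- The canonical projection `A → A / Id(S)`. -/
def mk : A →ₗ[k] QuotAlg k S := (idealGen k S).mkQ

theorem mk_surjective : Function.Surjective (mk k S) := (idealGen k S).mkQ_surjective

theorem mk_eq_mk_iff {a b : A} : mk k S a = mk k S b ↔ a - b ∈ idealGen k S :=
  Submodule.Quotient.eq (idealGen k S)

/-- The product of classes is the class of the product. -/
instance : Mul (QuotAlg k S) where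
  mul := Quotient.map₂ (· * ·) (by
    intro a a' ha b b' hb
    have ha' : a - a' ∈ idealGen k S := (Submodule.quotientRel_def _).1 ha
    have hb' : b - b' ∈ idealGen k S := (Submodule.quotientRel_def _).1 hb
    refine (Submodule.quotientRel_def _).2 ?_
    have h : a * b - a' * b' = (a - a') * b + a' * (b - b') := by
      rw [sub_mul, mul_sub]; abel
    rw [h]
    exact add_mem (isAlgIdeal_idealGen k S b _ ha').2 (isAlgIdeal_idealGen k S a' _ hb').1)

theorem mk_mul (a b : A) : mk k S (a * b) = mk k S a * mk k S b := rfl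

instance : NonUnitalNonAssocRing (QuotAlg k S) where
  left_distrib x y z := by
    obtain ⟨a, rfl⟩ := mk_surjective k S x
    obtain ⟨b, rfl⟩ := mk_surjective k S y
    obtain ⟨c, rfl⟩ := mk_surjective k S z
    simp only [← map_add, ← mk_mul, mul_add]
  right_distrib x y z := by
    obtain ⟨a, rfl⟩ := mk_surjective k S x
    obtain ⟨b, rfl⟩ := mk_surjective k S y
    obtain ⟨c, rfl⟩ := mk_surjective k S z
    simp only [← map_add, ← mk_mul, add_mul]
  zero_mul x := by
    obtain ⟨a, rfl⟩ := mk_surjective k S x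
    rw [← map_zero (mk k S), ← mk_mul, zero_mul]
  mul_zero x := by
    obtain ⟨a, rfl⟩ := mk_surjective k S x
    rw [← map_zero (mk k S), ← mk_mul, mul_zero]

instance [IsScalarTower k A A] : IsScalarTower k (QuotAlg k S) (QuotAlg k S) where
  smul_assoc c x y := by
    obtain ⟨a, rfl⟩ := mk_surjective k S x
    obtain ⟨b, rfl⟩ := mk_surjective k S y
    simp only [smul_eq_mul, ← map_smul, ← mk_mul, smul_mul_assoc]

instance [SMulCommClass k A A] : SMulCommClass k (QuotAlg k S) (QuotAlg k S) where
  smul_comm c x y := by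
    obtain ⟨a, rfl⟩ := mk_surjective k S x
    obtain ⟨b, rfl⟩ := mk_surjective k S y
    simp only [smul_eq_mul, ← map_smul, ← mk_mul, mul_smul_comm]

instance [IsBicommutative A] : IsBicommutative (QuotAlg k S) where
  left_comm x y z := by
    obtain ⟨a, rfl⟩ := mk_surjective k S x
    obtain ⟨b, rfl⟩ := mk_surjective k S y
    obtain ⟨c, rfl⟩ := mk_surjective k S z
    simp only [← mk_mul, IsBicommutative.left_comm a b c]
  right_comm x y z := by
    obtain ⟨a, rfl⟩ := mk_surjective k S x
    obtain ⟨b, rfl⟩ := mk_surjective k S y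
    obtain ⟨c, rfl⟩ := mk_surjective k S z
    simp only [← mk_mul, IsBicommutative.right_comm a b c]

end QuotAlg

end Ideals

/-- All the elements `a(bc) - b(ac)` and `(ab)c - (ac)b` of an algebra. -/
def bicommIdentities (A : Type*) [NonUnitalNonAssocRing A] : Set A :=
  {f | ∃ a b c : A, f = a * (b * c) - b * (a * c) ∨ f = (a * b) * c - (a * c) * b}

/-- `BC(X)`: the free bicommutative algebra over `k` generated by `X`, that is, the free
nonassociative algebra modulo the ideal generated by all values of the bicommutative identities. -/
abbrev FreeBicomm (k X : Type*) [Field k] : Type _ :=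
  QuotAlg k (bicommIdentities (FreeNonUnitalNonAssocAlgebra k X))

namespace FreeBicomm

variable (k : Type*) {X : Type*} [Field k]

/-- The generators of the free bicommutative algebra. -/
noncomputable def of (x : X) : FreeBicomm k X := QuotAlg.mk k _ (FreeNonUnitalNonAssocAlgebra.of k x)

instance : IsBicommutative (FreeBicomm k X) where
  left_comm x y z := by
    obtain ⟨a, rfl⟩ := QuotAlg.mk_surjective k _ x
    obtain ⟨b, rfl⟩ := QuotAlg.mk_surjective k _ y
    obtain ⟨c, rfl⟩ := QuotAlg.mk_surjective k _ z
    simp only [← QuotAlg.mk_mul]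
    exact (QuotAlg.mk_eq_mk_iff k _).2 (subset_idealGen k _ ⟨a, b, c, Or.inl rfl⟩)
  right_comm x y z := by
    obtain ⟨a, rfl⟩ := QuotAlg.mk_surjective k _ x
    obtain ⟨b, rfl⟩ := QuotAlg.mk_surjective k _ y
    obtain ⟨c, rfl⟩ := QuotAlg.mk_surjective k _ z
    simp only [← QuotAlg.mk_mul]
    exact (QuotAlg.mk_eq_mk_iff k _).2 (subset_idealGen k _ ⟨a, b, c, Or.inr rfl⟩)

end FreeBicomm

/-- `BC(X | S) = BC(X) / Id(S)`: the bicommutative algebra with generators `X` and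
defining relations `s = 0` for `s ∈ S`. -/
abbrev PresentedBicomm {k X : Type*} [Field k] (S : Set (FreeBicomm k X)) : Type _ :=
  QuotAlg k S

/-- The image in `BC(X | S)` of a generator. -/
noncomputable def PresentedBicomm.of {k X : Type*} [Field k] (S : Set (FreeBicomm k X)) (x : X) :
    PresentedBicomm S :=
  QuotAlg.mk k S (FreeBicomm.of k x)

/-! ### Coding of terms -/

/-- The code of a term (a bracketed word) in the letters `0, …, n`: the letter `i` has the
code `i`, and a product has the code `n + 1 + ⟨code of left factor, code of right factor⟩`. -/
def termCode {n : ℕ} : FreeMagma (Fin (n + 1)) → ℕ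
  | .of i => i
  | .mul s t => n + 1 + Nat.pair (termCode s) (termCode t)

/-- The term with a given code. -/
def termDecode (n : ℕ) (m : ℕ) : FreeMagma (Fin (n + 1)) :=
  if h : m < n + 1 then .of ⟨m, h⟩
  else .mul (termDecode n (m - (n + 1)).unpair.1) (termDecode n (m - (n + 1)).unpair.2)
termination_by m
decreasing_by
  · have := Nat.unpair_left_le (m - (n + 1)); omega
  · have := Nat.unpair_right_le (m - (n + 1)); omega

theorem termDecode_termCode {n : ℕ} (t : FreeMagma (Fin (n + 1))) :
    termDecode n (termCode t) = t := by
  induction t with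
  | ih1 i => rw [termCode, termDecode, dif_pos i.2]
  | ih2 s t hs ht =>
    change termDecode n (n + 1 + Nat.pair (termCode s) (termCode t)) = _
    rw [termDecode, dif_neg (by omega), Nat.add_sub_cancel_left, Nat.unpair_pair, hs, ht]
    rfl

theorem termCode_termDecode (n m : ℕ) : termCode (termDecode n m) = m := by
  induction m using Nat.strong_induction_on with
  | _ m ih =>
    rw [termDecode]
    split_ifs with h
    · rfl
    · have h1 := Nat.unpair_left_le (m - (n + 1))
      have h2 := Nat.unpair_right_le (m - (n + 1))
      rw [termCode, ih _ (by omega), ih _ (by omega), Nat.pair_unpair]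
      omega

/-- Terms in a nonempty finite alphabet correspond bijectively to their codes. -/
def termEquiv (n : ℕ) : FreeMagma (Fin (n + 1)) ≃ ℕ where
  toFun := termCode
  invFun := termDecode n
  left_inv := termDecode_termCode
  right_inv := termCode_termDecode n

theorem term_isEmpty : FreeMagma (Fin 0) → False
  | .of i => i.elim0
  | .mul s _ => term_isEmpty s

/-- There are no terms in the empty alphabet. -/
def termZeroEquiv : FreeMagma (Fin 0) ≃ Empty where
  toFun t := (term_isEmpty t).elim
  invFun e := e.elim
  left_inv t := (term_isEmpty t).elim
  right_inv e := e.elim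

instance termPrimcodable : (n : ℕ) → Primcodable (FreeMagma (Fin n))
  | 0 => Primcodable.ofEquiv Empty termZeroEquiv
  | n + 1 => Primcodable.ofEquiv ℕ (termEquiv n)

/-! ### The word problem -/

/-- A computable field: a field with a coding of its elements by natural numbers for which
the field operations are computable (equality is decidable because codes are unique). -/
structure IsComputableField (F : Type*) [Field F] [Primcodable F] : Prop where
  add : Computable₂ fun a b : F => a + b
  neg : Computable fun a : F => -a
  mul : Computable₂ fun a b : F => a * b
  inv : Computable fun a : F => a⁻¹

/-- A formal linear combination `a₁ t₁ + ⋯ + aᵣ tᵣ` of terms in the letters `x₁, …, xₙ`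
with coefficients in `F`, written as the list of the pairs `(aᵢ, tᵢ)`. -/
abbrev LinWord (F : Type*) (n : ℕ) : Type _ := List (F × FreeMagma (Fin n))

/-- The value of a formal linear combination of terms at the elements `x₁, …, xₙ` of a
`k`-algebra, where `F` is a subfield of `k`. -/
def LinWord.eval {F : Type*} [Field F] (k : Type*) [Field k] [Algebra F k] {n : ℕ} {B : Type*}
    [NonUnitalNonAssocRing B] [Module k B] (x : Fin n → B) (w : LinWord F n) : B :=
  (w.map fun p => algebraMap F k p.1 • FreeMagma.lift x p.2).sum

/-- The word problem of the bicommutative algebra `BC(x₁, …, xₙ | S)`, for words with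
coefficients in `F`, is solvable: there is an algorithm that decides, for any two formal linear
combinations of terms, whether they represent the same element of the algebra. -/
def WordProblemSolvable (F : Type*) [Field F] [Primcodable F] {k : Type*} [Field k] [Algebra F k]
    {n : ℕ} (S : Set (FreeBicomm k (Fin n))) : Prop :=
  ComputablePred fun p : LinWord F n × LinWord F n =>
    p.1.eval k (PresentedBicomm.of S) = p.2.eval k (PresentedBicomm.of S)

/-! The value of a bracketed word in a bicommutative algebra depends only on its monomial: a single
letter, or the two multisets of letters that are left, respectively right, factors of the subwords
containing them. The linear relations between the values of words therefore form a subspace `J` of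
the space of formal combinations of monomials, and `J` is closed under multiplication by generators
on either side. For a monomial order compatible with these multiplications, the products that are
leading monomials of `J` form an upper set of pairs of multisets, so by Dickson's lemma they are the
multiples of finitely many. Hence it is decidable whether a monomial is leading, and `J` is spanned
by the multiples of finitely many of its elements. Membership in `J` is then semi-decidable, by
enumerating combinations of these multiples, and so is non-membership: a vector lies outside `J` if
and only if it is congruent modulo `J` to a nonzero combination of monomials that are not leading.
-/

section Computability

variable {α β σ : Type*} [Primcodable α] [Primcodable β] [Primcodable σ]

theorem computable_list_foldl {f : α → List β} {g : α → σ} {h : α → σ × β → σ}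
    (hf : Computable f) (hg : Computable g) (hh : Computable₂ h) :
    Computable fun a => (f a).foldl (fun s b => h a (s, b)) (g a) := by
  have hstep : Computable₂ fun (a : α) (p : ℕ × σ) =>
      (Option.casesOn ((f a)[p.1]?) p.2 fun b => h a (p.2, b) : σ) := by
    refine Computable.option_casesOn (o := fun q : α × ℕ × σ => (f q.1)[q.2.1]?)
      (f := fun q => q.2.2) (g := fun q b => h q.1 (q.2.2, b)) ?_ (.comp .snd .snd) ?_
    · exact Computable.list_getElem?.comp (hf.comp .fst) (.comp .fst .snd)
    · exact hh.comp (.comp .fst .fst) (.pair (.comp .snd (.comp .snd .fst)) .snd)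
  refine (Computable.nat_rec (Computable.list_length.comp hf) hg hstep).of_eq fun a => ?_
  have foldl_take : ∀ k ≤ (f a).length,
      (Nat.rec (g a) (fun i s => (Option.casesOn ((f a)[i]?) s fun b => h a (s, b) : σ)) k : σ) =
        ((f a).take k).foldl (fun s b => h a (s, b)) (g a) := by
    intro k hk
    induction k with
    | zero => rfl
    | succ k ih =>
      have hk' : k < (f a).length := hk
      simp only [ih hk'.le, List.getElem?_eq_getElem hk', List.take_add_one, Option.toList_some,
        List.foldl_append, List.foldl_cons, List.foldl_nil]
  simpa only [List.take_length] using foldl_take _ le_rfl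

theorem computable_list_flatMap {f : α → List β} {g : α → β → List σ} (hf : Computable f)
    (hg : Computable₂ g) : Computable fun a => (f a).flatMap (g a) := by
  refine (computable_list_foldl (h := fun a p => p.1 ++ g a p.2) hf (.const []) ?_).of_eq
    fun a => List.flatMap_eq_foldl.symm
  exact Computable.list_append.comp (.comp .fst .snd) (hg.comp .fst (.comp .snd .snd))

theorem computable_list_map {f : α → List β} {g : α → β → σ} (hf : Computable f)
    (hg : Computable₂ g) : Computable fun a => (f a).map (g a) := by
  refine (computable_list_flatMap (g := fun a b => [g a b]) hf ?_).of_eq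
    fun a => List.flatMap_pure_eq_map _ _
  exact Computable.list_cons.comp hg (.const [])

theorem computablePred_comp {p : β → Prop} (hp : ComputablePred p) {f : α → β}
    (hf : Computable f) : ComputablePred fun a => p (f a) := by
  classical exact (hp.decide.comp hf).computablePred

theorem computablePred_and {p q : α → Prop} (hp : ComputablePred p) (hq : ComputablePred q) :
    ComputablePred fun a => p a ∧ q a := by
  classical
  refine Computable.computablePred ((Primrec.and.to_comp.comp hp.decide hq.decide).of_eq ?_)
  exact fun a => (Bool.decide_and _ _).symm

theorem computablePred_or {p q : α → Prop} (hp : ComputablePred p) (hq : ComputablePred q) :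
    ComputablePred fun a => p a ∨ q a := by
  classical
  refine Computable.computablePred ((Primrec.or.to_comp.comp hp.decide hq.decide).of_eq ?_)
  exact fun a => (Bool.decide_or _ _).symm

theorem computablePred_eq {f g : α → β} (hf : Computable f) (hg : Computable g) :
    ComputablePred fun a => f a = g a := by
  classical exact (Primrec.eq.decide.to_comp.comp hf hg).computablePred

theorem computablePred_forall_mem_list {f : α → List β} (hf : Computable f) {p : α → β → Prop}
    (hp : ComputablePred fun q : α × β => p q.1 q.2) :
    ComputablePred fun a => ∀ b ∈ f a, p a b := by
  classical
  refine Computable.computablePred ((computable_list_foldl (h := fun a s => s.1 && decide (p a s.2))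
    hf (.const true) ?_).of_eq fun a => ?_)
  · exact Primrec.and.to_comp.comp (.comp .fst .snd)
      (hp.decide.comp (.pair .fst (.comp .snd .snd)))
  · have foldl_and : ∀ (l : List β) (s : Bool),
        l.foldl (fun s b => s && decide (p a b)) s = (s && decide (∀ b ∈ l, p a b)) := by
      intro l
      induction l with
      | nil => simp
      | cons b l ih => intro s; simp [ih, Bool.and_assoc]
    simpa using foldl_and (f a) true

theorem rePred_exists {p : α → β → Prop} (hp : ComputablePred fun q : α × β => p q.1 q.2) :
    REPred fun a => ∃ b, p a b := by
  classical
  have hdec : Computable₂ fun a b => decide (p a b) := hp.decide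
  have hsearch : Computable₂ fun (a : α) (i : ℕ) =>
      (Encodable.decode i : Option β).bind fun b => bif decide (p a b) then some b else none := by
    refine Computable.option_bind
      (f := fun q : α × ℕ => (Encodable.decode q.2 : Option β))
      (g := fun q b => bif decide (p q.1 b) then some b else none)
      (Computable.decode.comp .snd)
      (Computable.cond ?_ (Computable.option_some.comp .snd) (.const none))
    exact hdec.comp (.comp .fst .fst) .snd
  refine (Partrec.rfindOpt hsearch).dom_re.of_eq fun a => Nat.rfindOpt_dom.trans ⟨?_, ?_⟩
  · rintro ⟨i, b, hib⟩
    obtain ⟨b, -, hb⟩ := Option.bind_eq_some_iff.1 hib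
    refine ⟨b, by_contra fun hpb => ?_⟩
    simp [hpb] at hb
  · rintro ⟨b, hb⟩
    exact ⟨Encodable.encode b, b, by simp [hb]⟩

end Computability

theorem exists_add_mem_and_ne_zero_iff_notMem {R M : Type*} [Ring R] [AddCommGroup M] [Module R M]
    {J K : Submodule R M} (h : IsCompl J K) {w : M} :
    (∃ g ∈ J, g + w ∈ K ∧ g + w ≠ 0) ↔ w ∉ J := by
  constructor
  · rintro ⟨g, hg, hK, hne⟩ hw
    exact hne (Submodule.disjoint_def.1 h.disjoint _ (add_mem hg hw) hK)
  · intro hw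
    obtain ⟨g, hg, r, hr, hgr⟩ :=
      Submodule.mem_sup.1 (h.sup_eq_top ▸ Submodule.mem_top : w ∈ J ⊔ K)
    have hr_eq : -g + w = r := by rw [← hgr, neg_add_cancel_left]
    refine ⟨-g, neg_mem hg, hr_eq ▸ hr, fun h0 => hw ?_⟩
    rwa [← neg_add_eq_zero.1 h0]

section FormalSums

variable {R ι κ : Type*} [Semiring R]

/-- The finitely supported function `∑ cⱼ · iⱼ` represented by a list of pairs `(cⱼ, iⱼ)`. Repeated
indices and zero coefficients are allowed. -/
noncomputable def listSum (l : List (R × ι)) : ι →₀ R :=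
  (l.map fun e => Finsupp.single e.2 e.1).sum

theorem listSum_nil : listSum ([] : List (R × ι)) = 0 := rfl

theorem listSum_cons (e : R × ι) (l : List (R × ι)) :
    listSum (e :: l) = Finsupp.single e.2 e.1 + listSum l :=
  List.sum_cons

theorem listSum_append (l l' : List (R × ι)) : listSum (l ++ l') = listSum l + listSum l' := by
  simp only [listSum, List.map_append, List.sum_append]

theorem listSum_surjective : Function.Surjective (listSum : List (R × ι) → ι →₀ R) := by
  intro f
  refine ⟨f.support.toList.map fun i => (f i, i), ?_⟩
  rw [listSum, List.map_map]
  exact (Finset.sum_map_toList f.support _).trans f.sum_single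

theorem linearCombination_listSum {M : Type*} [AddCommMonoid M] [Module R M] (v : ι → M)
    (l : List (R × ι)) :
    Finsupp.linearCombination R v (listSum l) = (l.map fun e => e.1 • v e.2).sum := by
  rw [listSum, map_list_sum, List.map_map]
  simp only [Function.comp_def, Finsupp.linearCombination_single]

/-- The formal sum obtained from `∑ cⱼ · iⱼ` by substituting the formal sum `v iⱼ` for each `iⱼ`. -/
def listBind (l : List (R × κ)) (v : κ → List (R × ι)) : List (R × ι) :=
  l.flatMap fun e => (v e.2).map fun p => (e.1 * p.1, p.2)

theorem listSum_map (g : κ → ι) (l : List (R × κ)) :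
    listSum (l.map fun p => (p.1, g p.2)) = Finsupp.mapDomain g (listSum l) := by
  induction l with
  | nil => exact Finsupp.mapDomain_zero.symm
  | cons e l ih =>
    rw [List.map_cons, listSum_cons, listSum_cons, ih, Finsupp.mapDomain_add,
      Finsupp.mapDomain_single]

theorem listSum_map_mul (c : R) (l : List (R × ι)) :
    listSum (l.map fun p => (c * p.1, p.2)) = c • listSum l := by
  induction l with
  | nil => exact (smul_zero c).symm
  | cons e l ih =>
    rw [List.map_cons, listSum_cons, listSum_cons, ih, smul_add, Finsupp.smul_single, smul_eq_mul]

theorem listSum_listBind (v : κ → List (R × ι)) (l : List (R × κ)) :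
    listSum (listBind l v) = Finsupp.linearCombination R (fun j => listSum (v j)) (listSum l) := by
  induction l with
  | nil => simp [listBind, listSum_nil]
  | cons e l ih =>
    rw [listSum_cons, map_add, ← ih, Finsupp.linearCombination_single, ← listSum_map_mul]
    exact listSum_append _ _

theorem mem_span_range_listSum_iff {v : κ → List (R × ι)} {g : ι →₀ R} :
    g ∈ Submodule.span R (Set.range fun j => listSum (v j)) ↔ ∃ l, listSum (listBind l v) = g := by
  simp only [listSum_listBind, Finsupp.mem_span_range_iff_exists_finsupp,
    listSum_surjective.exists, Finsupp.linearCombination_apply]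

theorem listSum_mem_supported_iff {B : Set ι} {l : List (R × ι)} :
    listSum l ∈ Finsupp.supported R R B ↔ ∀ e ∈ l, e.2 ∈ B ∨ listSum l e.2 = 0 := by
  classical
  rw [Finsupp.mem_supported']
  refine ⟨fun h e _ => or_iff_not_imp_left.2 (h e.2), fun h i hi => by_contra fun hne => ?_⟩
  have hmem : ∃ e ∈ l, e.2 = i := by
    by_contra! hl
    refine hne ?_
    clear h hne
    induction l with
    | nil => rfl
    | cons e l ih =>
      rw [listSum_cons, Finsupp.add_apply, ih fun e' he' => hl e' (List.mem_cons_of_mem e he'),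
        Finsupp.single_eq_of_ne (hl e List.mem_cons_self).symm, add_zero]
  obtain ⟨e, he, rfl⟩ := hmem
  exact (h e he).elim hi hne

variable {F : Type*} [Field F] [Primcodable F] [Primcodable ι] [Primcodable κ]

theorem computable_listSum_apply (hF : IsComputableField F) :
    Computable₂ fun (l : List (F × ι)) (i : ι) => listSum l i := by
  classical
  refine (computable_list_foldl (f := fun q : List (F × ι) × ι => q.1)
    (h := fun q s => bif s.2.2 == q.2 then s.1 + s.2.1 else s.1) .fst (.const 0)
    (.cond ?_ ?_ (.comp .fst .snd))).of_eq fun q => ?_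
  · exact Primrec.beq.to_comp.comp (Computable.snd.comp (.comp .snd .snd)) (.comp .snd .fst)
  · exact hF.add.comp (.comp .fst .snd) (.comp .fst (.comp .snd .snd))
  · have foldl_add : ∀ (l : List (F × ι)) (s : F),
        l.foldl (fun s e => bif e.2 == q.2 then s + e.1 else s) s = s + listSum l q.2 := by
      intro l
      induction l with
      | nil => simp [listSum_nil]
      | cons e l ih =>
        intro s
        rw [List.foldl_cons, ih, listSum_cons, Finsupp.add_apply, ← add_assoc]
        by_cases h : e.2 = q.2
        · simp [h]
        · simp [beq_false_of_ne h, h]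
    simpa using foldl_add q.1 0

theorem computable_listBind (hF : IsComputableField F) {v : κ → List (F × ι)} (hv : Computable v) :
    Computable fun l : List (F × κ) => listBind l v := by
  refine computable_list_flatMap (f := fun l : List (F × κ) => l)
    (g := fun _ e => (v e.2).map fun p => (e.1 * p.1, p.2)) .id
    (computable_list_map (f := fun q : List (F × κ) × F × κ => v q.2.2)
      (g := fun q p => (q.2.1 * p.1, p.2)) (hv.comp (.comp .snd .snd)) ?_)
  exact .pair (hF.mul.comp (.comp .fst (.comp .snd .fst)) (.comp .fst .snd)) (.comp .snd .snd)

theorem computablePred_listSum_mem_supported (hF : IsComputableField F) {B : Set ι}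
    (hB : ComputablePred (· ∈ B)) :
    ComputablePred fun l : List (F × ι) => listSum l ∈ Finsupp.supported F F B := by
  refine (computablePred_forall_mem_list (f := fun l : List (F × ι) => l)
    (p := fun l e => e.2 ∈ B ∨ listSum l e.2 = 0) .id (computablePred_or ?_ ?_)).of_eq
    fun l => listSum_mem_supported_iff.symm
  · exact computablePred_comp hB (.comp .snd .snd)
  · exact computablePred_eq ((computable_listSum_apply hF).comp .fst (.comp .snd .snd)) (.const 0)

theorem computablePred_listSum_eq_zero (hF : IsComputableField F) :
    ComputablePred fun l : List (F × ι) => listSum l = 0 := by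
  have hempty : ComputablePred (· ∈ (∅ : Set ι)) := Computable.computablePred (.const false)
  simpa only [Finsupp.supported_empty, Submodule.mem_bot] using
    computablePred_listSum_mem_supported hF hempty

theorem rePred_exists_mem_span_add_listSum (hF : IsComputableField F) {v : κ → List (F × ι)}
    (hv : Computable v) {p : (ι →₀ F) → Prop}
    (hp : ComputablePred fun l : List (F × ι) => p (listSum l)) :
    REPred fun w : List (F × ι) =>
      ∃ g ∈ Submodule.span F (Set.range fun j => listSum (v j)), p (g + listSum w) := by
  have hadd : Computable fun q : List (F × ι) × List (F × κ) => listBind q.2 v ++ q.1 :=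
    Computable.list_append.comp ((computable_listBind hF hv).comp .snd) .fst
  refine (rePred_exists (p := fun w l => p (listSum (listBind l v ++ w)))
    (computablePred_comp hp hadd)).of_eq fun w => ?_
  simp only [mem_span_range_listSum_iff, listSum_append, exists_exists_eq_and]

/-- Both membership and non-membership are semi-decidable: a vector lies outside `J` if and only if
it is congruent modulo `J` to a nonzero vector supported in `B`. -/
theorem computablePred_listSum_mem (hF : IsComputableField F) {J : Submodule F (ι →₀ F)} {B : Set ι}
    (hB : ComputablePred (· ∈ B)) (hJB : IsCompl J (Finsupp.supported F F B))
    {v : κ → List (F × ι)} (hv : Computable v)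
    (hspan : Submodule.span F (Set.range fun j => listSum (v j)) = J) :
    ComputablePred fun w : List (F × ι) => listSum w ∈ J := by
  have hzero := computablePred_listSum_eq_zero (ι := ι) hF
  have hreduced := computablePred_and (computablePred_listSum_mem_supported hF hB) hzero.not
  refine ComputablePred.computable_iff_re_compl_re'.2 ⟨?_, ?_⟩
  · refine (rePred_exists_mem_span_add_listSum hF hv (p := (· = 0)) hzero).of_eq fun w => ?_
    simp only [hspan, add_eq_zero_iff_eq_neg, exists_eq_right, neg_mem_iff]
  · refine (rePred_exists_mem_span_add_listSum hF hv
      (p := fun f => f ∈ Finsupp.supported F F B ∧ f ≠ 0) hreduced).of_eq fun w => ?_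
    rw [hspan, exists_add_mem_and_ne_zero_iff_notMem hJB]

end FormalSums

section LeadingIndices

variable {R ι κ : Type*} [Semiring R] [LinearOrder ι]

/-- The vector `f` has leading index `i`, with leading coefficient one. -/
def IsMonicAt (f : ι →₀ R) (i : ι) : Prop :=
  f i = 1 ∧ ∀ j, f j ≠ 0 → j ≤ i

/-- The leading indices of the nonzero vectors of a subspace. -/
def leadIndices (J : Submodule R (ι →₀ R)) : Set ι :=
  {i | ∃ f ∈ J, IsMonicAt f i}

theorem IsMonicAt.mapDomain [LinearOrder κ] {f : ι →₀ R} {i : ι}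
    (hf : IsMonicAt f i) {g : ι → κ} (hg : ∀ j < i, g j < g i) :
    IsMonicAt (Finsupp.mapDomain g f) (g i) := by
  classical
  have hlt : ∀ l ∈ (Finsupp.mapDomain g (f.erase i)).support, l < g i := by
    intro l hl
    obtain ⟨j, hj, rfl⟩ := Finset.mem_image.1 (Finsupp.mapDomain_support hl)
    obtain ⟨hji, hj⟩ := Finset.mem_erase.1 (Finsupp.support_erase (f := f) ▸ hj)
    exact hg j ((hf.2 j (Finsupp.mem_support_iff.1 hj)).lt_of_ne hji)
  have hsplit : Finsupp.mapDomain g f =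
      Finsupp.single (g i) 1 + Finsupp.mapDomain g (f.erase i) := by
    rw [← hf.1, ← Finsupp.mapDomain_single, ← Finsupp.mapDomain_add, Finsupp.single_add_erase]
  have htail : Finsupp.mapDomain g (f.erase i) (g i) = 0 :=
    Finsupp.notMem_support_iff.1 fun h => (hlt _ h).false
  refine ⟨by rw [hsplit, Finsupp.add_apply, Finsupp.single_eq_same, htail, add_zero],
    fun j hj => le_of_not_gt fun hij => hj ?_⟩
  rw [hsplit, Finsupp.add_apply, Finsupp.single_eq_of_ne hij.ne',
    Finsupp.notMem_support_iff.1 fun h => (hlt j h).asymm hij, add_zero]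

variable {F : Type*} [Field F]

theorem exists_mem_support_mem_leadIndices {J : Submodule F (ι →₀ F)} {f : ι →₀ F} (hf : f ∈ J)
    (hf0 : f ≠ 0) : ∃ i ∈ f.support, i ∈ leadIndices J := by
  have hne : f.support.Nonempty := Finsupp.support_nonempty_iff.2 hf0
  have hi := f.support.max'_mem hne
  refine ⟨_, hi, (f (f.support.max' hne))⁻¹ • f, J.smul_mem _ hf, ?_, fun j hj => ?_⟩
  · exact inv_mul_cancel₀ (Finsupp.mem_support_iff.1 hi)
  · exact f.support.le_max' j (Finsupp.mem_support_iff.2 (right_ne_zero_of_mul hj))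

theorem disjoint_supported_compl_leadIndices (J : Submodule F (ι →₀ F)) :
    Disjoint J (Finsupp.supported F F (leadIndices J)ᶜ) := by
  refine Submodule.disjoint_def.2 fun f hfJ hf => by_contra fun hf0 => ?_
  obtain ⟨i, hi, hiJ⟩ := exists_mem_support_mem_leadIndices hfJ hf0
  exact hf hi hiJ

variable [WellFoundedLT ι]

theorem span_sup_supported_compl_eq_top {R : Type*} [Ring R] {v : κ → ι →₀ R} {s : Set ι}
    (hv : ∀ i ∈ s, ∃ j, IsMonicAt (v j) i) :
    Submodule.span R (Set.range v) ⊔ Finsupp.supported R R sᶜ = ⊤ := by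
  set N := Submodule.span R (Set.range v) ⊔ Finsupp.supported R R sᶜ
  have supported_le : ∀ t : Set ι, (∀ i ∈ t, Finsupp.single i 1 ∈ N) →
      Finsupp.supported R R t ≤ N := fun t ht => by
    rw [Finsupp.supported_eq_span_single, Submodule.span_le]
    exact Set.image_subset_iff.2 ht
  have single_mem : ∀ i, Finsupp.single i 1 ∈ N := by
    intro i
    induction i using WellFoundedLT.induction with
    | ind i ih =>
      by_cases hi : i ∈ s
      · obtain ⟨j, hj1, hj⟩ := hv i hi
        have htail : (v j).erase i ∈ N := by
          refine supported_le (Set.Iio i) ih fun l hl => ?_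
          obtain ⟨hli, hl⟩ := Finset.mem_erase.1 (Finsupp.support_erase (f := v j) ▸ hl)
          exact (hj l (Finsupp.mem_support_iff.1 hl)).lt_of_ne hli
        have hvj : v j ∈ N :=
          Submodule.mem_sup_left (Submodule.subset_span (Set.mem_range_self j))
        rw [← Finsupp.single_add_erase i (v j), hj1] at hvj
        exact (Submodule.add_mem_iff_left N htail).1 hvj
      · exact Submodule.mem_sup_right (Finsupp.single_mem_supported R _ hi)
  rw [eq_top_iff, ← Finsupp.supported_univ]
  exact supported_le Set.univ fun i _ => single_mem i

theorem isCompl_supported_compl_leadIndices (J : Submodule F (ι →₀ F)) :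
    IsCompl J (Finsupp.supported F F (leadIndices J)ᶜ) := by
  refine ⟨disjoint_supported_compl_leadIndices J, codisjoint_iff.2 ?_⟩
  simpa using span_sup_supported_compl_eq_top (v := ((↑) : J → ι →₀ F)) (s := leadIndices J)
    fun i ⟨f, hf, hfi⟩ => ⟨⟨f, hf⟩, hfi⟩

theorem span_eq_of_forall_leadIndices {J : Submodule F (ι →₀ F)} {v : κ → ι →₀ F}
    (hvJ : ∀ j, v j ∈ J) (hv : ∀ i ∈ leadIndices J, ∃ j, IsMonicAt (v j) i) :
    Submodule.span F (Set.range v) = J := by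
  refine eq_of_le_of_inf_le_of_sup_le (z := Finsupp.supported F F (leadIndices J)ᶜ)
    (Submodule.span_le.2 (Set.range_subset_iff.2 hvJ)) ?_ ?_
  · exact (disjoint_supported_compl_leadIndices J).le_bot.trans bot_le
  · exact le_top.trans (span_sup_supported_compl_eq_top hv).ge

theorem computablePred_listSum_mem_of_leadIndices [Primcodable F] [Primcodable ι] [Primcodable κ]
    (hF : IsComputableField F) {J : Submodule F (ι →₀ F)}
    (hJ : ComputablePred (· ∈ leadIndices J)) {v : κ → List (F × ι)} (hv : Computable v)
    (hvJ : ∀ j, listSum (v j) ∈ J) (hlead : ∀ i ∈ leadIndices J, ∃ j, IsMonicAt (listSum (v j)) i) :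
    ComputablePred fun w : List (F × ι) => listSum w ∈ J :=
  computablePred_listSum_mem hF hJ.not (isCompl_supported_compl_leadIndices J) hv
    (span_eq_of_forall_leadIndices hvJ hlead)

end LeadingIndices

section UpperSets

variable {α : Type*} [PartialOrder α] [WellQuasiOrderedLE α]

theorem exists_finset_forall_mem_iff_of_isUpperSet {U : Set α} (hU : IsUpperSet U) :
    ∃ s : Finset α, ∀ a, a ∈ U ↔ ∃ m ∈ s, m ≤ a := by
  have hfin : {a | Minimal (· ∈ U) a}.Finite :=
    WellQuasiOrderedLE.finite_of_isAntichain (setOfPred_minimal_antichain _)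
  refine ⟨hfin.toFinset, fun a => ⟨fun ha => ?_, fun ⟨m, hm, hma⟩ => ?_⟩⟩
  · obtain ⟨m, hma, hm⟩ := exists_minimal_le_of_wellFoundedLT _ a ha
    exact ⟨m, hfin.mem_toFinset.2 hm, hma⟩
  · exact hU hma (hfin.mem_toFinset.1 hm).prop

theorem computablePred_mem_of_isUpperSet [Primcodable α]
    (hle : PrimrecRel fun a b : α => a ≤ b) {U : Set α} (hU : IsUpperSet U) :
    ComputablePred (· ∈ U) := by
  classical
  obtain ⟨s, hs⟩ := exists_finset_forall_mem_iff_of_isUpperSet hU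
  refine ((PrimrecRel.exists_mem_list hle).comp (.const s.toList) .id).computablePred.of_eq
    fun a => ?_
  simp only [Finset.mem_toList, id_eq, hs]

end UpperSets

namespace IsBicommutative

variable {A : Type*} [Mul A] [IsBicommutative A] {X : Type*} (x : X → A)

/-- The common value is `p(xq · y)`. -/
theorem mul_mul_mul_right (x y p q : A) : x * (p * q * y) = x * (p * q) * y := by
  have hleft : x * (p * q * y) = p * (x * q * y) := by
    rw [left_comm x (p * q) y, right_comm p q (x * y), left_comm p x y, right_comm x (p * y) q,
      left_comm (x * q) p y]
  have hright : x * (p * q) * y = p * (x * q * y) := by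
    rw [right_comm x (p * q) y, left_comm (x * y) p q, right_comm x y q]
  rw [hleft, hright]

instance rightCommutative_mulLeft : RightCommutative fun (u : A) i => x i * u :=
  ⟨fun u i j => left_comm (x j) (x i) u⟩

instance rightCommutative_mulRight : RightCommutative fun (u : A) i => u * x i :=
  ⟨fun u i j => right_comm u (x i) (x j)⟩

/-- Left multiplication of `u` by the elements `x i`, for `i` running through a multiset. -/
def mulLeft (a : Multiset X) (u : A) : A :=
  a.foldl (fun u i => x i * u) u

/-- Right multiplication of `u` by the elements `x i`, for `i` running through a multiset. -/
def mulRight (b : Multiset X) (u : A) : A :=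
  b.foldl (fun u i => u * x i) u

theorem mulLeft_cons (i : X) (a : Multiset X) (u : A) :
    mulLeft x (i ::ₘ a) u = mulLeft x a (x i * u) :=
  Multiset.foldl_cons _ _ _ _

theorem mulRight_cons (i : X) (b : Multiset X) (u : A) :
    mulRight x (i ::ₘ b) u = mulRight x b (u * x i) :=
  Multiset.foldl_cons _ _ _ _

theorem mulLeft_mul_mul (a : Multiset X) (p q y : A) :
    mulLeft x a (p * q) * y = mulLeft x a (p * q * y) := by
  induction a using Multiset.induction generalizing p q with
  | empty => rfl
  | cons i a ih => rw [mulLeft_cons, mulLeft_cons, ih, mul_mul_mul_right]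

theorem mulLeft_mulRight_mul (a b : Multiset X) (p q : A) :
    mulLeft x a (mulRight x b (p * q)) = mulRight x b (mulLeft x a (p * q)) := by
  induction b using Multiset.induction generalizing p q with
  | empty => rfl
  | cons i b ih => rw [mulRight_cons, mulRight_cons, ih, mulLeft_mul_mul]

/-- The action on `A` of a pair of multisets, one of left and one of right multiplications. It is
independent of the order of all these multiplications on products, but not on other elements. -/
def sandwich (m : Multiset X × Multiset X) (u : A) : A :=
  mulLeft x m.1 (mulRight x m.2 u)

theorem sandwich_sandwich_mul (m m' : Multiset X × Multiset X) (p q : A) :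
    sandwich x m (sandwich x m' (p * q)) = sandwich x (m + m') (p * q) := by
  have mulRight_mulRight : ∀ u, mulRight x m.2 (mulRight x m'.2 u) = mulRight x (m + m').2 u :=
    fun u => by rw [Prod.snd_add, add_comm]; exact (Multiset.foldl_add _ _ _ _).symm
  have mulLeft_mulLeft : ∀ u, mulLeft x m.1 (mulLeft x m'.1 u) = mulLeft x (m + m').1 u :=
    fun u => by rw [Prod.fst_add, add_comm]; exact (Multiset.foldl_add _ _ _ _).symm
  simp only [sandwich]
  rw [mulLeft_mulRight_mul x m'.1, mulRight_mulRight, ← mulLeft_mulRight_mul, mulLeft_mulLeft]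

theorem sandwich_mul_congr {m m' : Multiset X × Multiset X} {a b a' b' : X}
    (h : m + ({a}, {b}) = m' + ({a'}, {b'})) :
    sandwich x m (x a * x b) = sandwich x m' (x a' * x b') := by
  have hleft : a ::ₘ m.1 = a' ::ₘ m'.1 := by
    simpa [← Multiset.singleton_add, add_comm] using congrArg Prod.fst h
  have hright : b ::ₘ m.2 = b' ::ₘ m'.2 := by
    simpa [← Multiset.singleton_add, add_comm] using congrArg Prod.snd h
  calc sandwich x m (x a * x b)
      = mulRight x m.2 (mulLeft x (a ::ₘ m.1) (x b)) := by
        rw [sandwich, mulLeft_mulRight_mul, mulLeft_cons]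
    _ = mulLeft x m'.1 (mulRight x (b ::ₘ m.2) (x a')) := by
        rw [hleft, mulLeft_cons, ← mulLeft_mulRight_mul, mulRight_cons]
    _ = sandwich x m' (x a' * x b') := by
        rw [hright, mulRight_cons, sandwich]

end IsBicommutative

/-- The monomials of the free bicommutative algebra on `X`: the generators, and the products, which
are determined by two multisets of letters: those that are left factors, and those that are right
factors, of the subwords containing them. For example `(x₁ (x₂ x₃)) x₄` is `prod ({1, 2}, {3, 4})`.
Both multisets of an actual product are nonempty, which is not required here. -/
inductive BicommMonomial (X : Type*)
  | gen (i : X)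
  | prod (m : Multiset X × Multiset X)

namespace BicommMonomial

variable {X : Type*}

/-- The contribution of a monomial to a product in which it is the left factor. -/
def asLeft : BicommMonomial X → Multiset X × Multiset X
  | gen i => ({i}, 0)
  | prod m => m

/-- The contribution of a monomial to a product in which it is the right factor. -/
def asRight : BicommMonomial X → Multiset X × Multiset X
  | gen i => (0, {i})
  | prod m => m

instance : Mul (BicommMonomial X) :=
  ⟨fun s t => prod (s.asLeft + t.asRight)⟩

theorem mul_def (s t : BicommMonomial X) : s * t = prod (s.asLeft + t.asRight) := rfl

instance : IsBicommutative (BicommMonomial X) where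
  left_comm s t u := congrArg prod (add_left_comm s.asLeft t.asLeft u.asRight)
  right_comm s t u := congrArg prod (add_right_comm s.asLeft t.asRight u.asRight)

/-- The monomial of a nonassociative word. -/
def ofWord : FreeMagma X →ₙ* BicommMonomial X :=
  FreeMagma.lift gen

theorem ofWord_mul (s t : FreeMagma X) :
    ofWord (s * t) = prod ((ofWord s).asLeft + (ofWord t).asRight) :=
  map_mul ofWord s t

open IsBicommutative

theorem sandwich_gen_prod (a m : Multiset X × Multiset X) :
    sandwich gen a (prod m) = prod (a + m) := by
  have mulRight_gen : ∀ b m, mulRight gen b (prod m) = prod ((0, b) + m : Multiset X × _) := by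
    intro b
    induction b using Multiset.induction with
    | empty => intro m; simp [mulRight]
    | cons i b ih =>
      intro m
      rw [mulRight_cons, mul_def, ih]
      simp [asLeft, asRight, ← Multiset.singleton_add, add_comm, add_left_comm]
  have mulLeft_gen : ∀ b m, mulLeft gen b (prod m) = prod ((b, 0) + m : _ × Multiset X) := by
    intro b
    induction b using Multiset.induction with
    | empty => intro m; simp [mulLeft]
    | cons i b ih =>
      intro m
      rw [mulLeft_cons, mul_def, ih]
      simp [asLeft, asRight, ← Multiset.singleton_add, add_comm, add_left_comm]
  rw [sandwich, mulRight_gen, mulLeft_gen, ← add_assoc]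
  simp

variable {A : Type*} [Mul A] [IsBicommutative A] (x : X → A)

theorem lift_mul_mul_eq_sandwich (t : FreeMagma X) (p q : A) :
    FreeMagma.lift x t * (p * q) = sandwich x (ofWord t).asLeft (p * q) ∧
      p * q * FreeMagma.lift x t = sandwich x (ofWord t).asRight (p * q) := by
  induction t generalizing p q with
  | ih1 i => exact ⟨rfl, rfl⟩
  | ih2 s t hs ht =>
    rw [ofWord_mul, map_mul]
    constructor
    · rw [right_comm, (ht _ _).2, (hs p q).1, sandwich_sandwich_mul, add_comm, asLeft]
    · rw [left_comm, (hs _ _).1, (ht p q).2, sandwich_sandwich_mul, asRight]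

theorem exists_lift_eq_sandwich (t : FreeMagma X) {μ : Multiset X × Multiset X}
    (ht : ofWord t = prod μ) :
    ∃ m a b, μ = m + ({a}, {b}) ∧ FreeMagma.lift x t = sandwich x m (x a * x b) := by
  induction t generalizing μ with
  | ih1 i => cases ht
  | ih2 s t hs ht' =>
    rw [ofWord_mul] at ht
    obtain rfl := prod.inj ht
    cases t with
    | mul t₁ t₂ =>
      obtain ⟨m, a, b, hm, hval⟩ := ht' (μ := (ofWord (t₁ * t₂)).asRight) rfl
      refine ⟨(ofWord s).asLeft + m, a, b, ?_, ?_⟩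
      · rw [add_assoc, ← hm]; rfl
      · rw [← sandwich_sandwich_mul, ← hval, map_mul]
        exact (lift_mul_mul_eq_sandwich x s (FreeMagma.lift x t₁) (FreeMagma.lift x t₂)).1
    | of j =>
      cases s with
      | mul s₁ s₂ =>
        obtain ⟨m, a, b, hm, hval⟩ := hs (μ := (ofWord (s₁ * s₂)).asLeft) rfl
        refine ⟨(0, {j}) + m, a, b, ?_, ?_⟩
        · rw [add_assoc, ← hm, add_comm]; rfl
        · rw [← sandwich_sandwich_mul, ← hval, map_mul]
          exact (lift_mul_mul_eq_sandwich x (.of j) (FreeMagma.lift x s₁) (FreeMagma.lift x s₂)).2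
      | of i => exact ⟨0, i, j, by simp [ofWord, asLeft, asRight], rfl⟩

theorem lift_eq_of_ofWord_eq {s t : FreeMagma X} (h : ofWord s = ofWord t) :
    FreeMagma.lift x s = FreeMagma.lift x t := by
  cases hμ : ofWord s with
  | gen i =>
    have eq_of : ∀ u : FreeMagma X, ofWord u = gen i → u = .of i := by
      rintro (j | _) hu
      · rw [gen.inj hu]
      · cases hu
    rw [eq_of s hμ, eq_of t (h ▸ hμ)]
  | prod μ =>
    obtain ⟨m, a, b, hm, hs⟩ := exists_lift_eq_sandwich x s hμ
    obtain ⟨m', a', b', hm', ht⟩ := exists_lift_eq_sandwich x t (h ▸ hμ)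
    rw [hs, ht, sandwich_mul_congr x (hm.symm.trans hm')]

end BicommMonomial

section Multisets

variable {α : Type*} [Primcodable α] {n : ℕ}

noncomputable instance multisetFinPrimcodable : Primcodable (Multiset (Fin n)) :=
  Primcodable.ofEquiv (Fin n → ℕ) (Multiset.toFinsupp.toEquiv.trans Finsupp.equivFunOnFinite)

theorem primrec_multiset_iff_count {f : α → Multiset (Fin n)} :
    Primrec f ↔ Primrec₂ fun a i => (f a).count i := by
  rw [← Primrec.of_equiv_iff (Multiset.toFinsupp.toEquiv.trans Finsupp.equivFunOnFinite),
    ← Primrec.fin_curry]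
  rfl

theorem primrec_multiset_count : Primrec₂ fun (m : Multiset (Fin n)) i => m.count i :=
  primrec_multiset_iff_count.1 .id

theorem primrec_multiset_add : Primrec₂ fun m m' : Multiset (Fin n) => m + m' := by
  refine primrec_multiset_iff_count.2 ((Primrec.nat_add.comp (α := (_ × _) × Fin n)
    (primrec_multiset_count.comp (.comp .fst .fst) .snd)
    (primrec_multiset_count.comp (.comp .snd .fst) .snd)).of_eq fun q => ?_)
  exact (Multiset.count_add _ _ _).symm

theorem primrecRel_multiset_le : PrimrecRel fun m m' : Multiset (Fin n) => m ≤ m' := by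
  have hcount : PrimrecRel fun (i : Fin n) (q : Multiset (Fin n) × Multiset (Fin n)) =>
      q.1.count i ≤ q.2.count i :=
    Primrec.nat_le.comp (primrec_multiset_count.comp (.comp .fst .snd) .fst)
      (primrec_multiset_count.comp (.comp .snd .snd) .fst)
  refine ((hcount.forall_mem_list).comp (.const (List.finRange n)) .id).of_eq fun q => ?_
  simp [Multiset.le_iff_count]

instance wellQuasiOrderedLE_multiset {X : Type*} [Finite X] : WellQuasiOrderedLE (Multiset X) := by
  classical exact (Finsupp.orderIsoMultiset (ι := X)).wellQuasiOrderedLE_iff.1 inferInstance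

end Multisets

namespace BicommMonomial

section Order

variable {X : Type*} [LinearOrder X]

/-- The exponents of a pair of multisets, compared lexicographically. -/
noncomputable def exponents (m : Multiset X × Multiset X) : Lex (X →₀ ℕ) ×ₗ Lex (X →₀ ℕ) :=
  toLex (toLex (Multiset.toFinsupp m.1), toLex (Multiset.toFinsupp m.2))

theorem exponents_add (m m' : Multiset X × Multiset X) :
    exponents (m + m') = exponents m + exponents m' := by
  simp only [exponents, Prod.fst_add, Prod.snd_add, map_add]
  rfl

theorem exponents_injective : Function.Injective (exponents (X := X)) := fun _ _ h =>
  Prod.ext (Multiset.toFinsupp.injective (Prod.ext_iff.1 h).1)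
    (Multiset.toFinsupp.injective (Prod.ext_iff.1 h).2)

/-- The key by which monomials are compared: products come before generators, so that a relation
with a leading product involves no generators. -/
noncomputable def orderKey : BicommMonomial X → Bool ×ₗ Lex (X →₀ ℕ) ×ₗ Lex (X →₀ ℕ)
  | prod m => toLex (false, exponents m)
  | gen i => toLex (true, exponents ({i}, 0))

theorem orderKey_injective : Function.Injective (orderKey (X := X)) := by
  rintro (i | m) (j | m') h
  · simpa using exponents_injective (Prod.ext_iff.1 h).2
  · exact absurd (Prod.ext_iff.1 h).1 Bool.noConfusion
  · exact absurd (Prod.ext_iff.1 h).1 Bool.noConfusion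
  · exact congrArg prod (exponents_injective (Prod.ext_iff.1 h).2)

noncomputable instance : LinearOrder (BicommMonomial X) :=
  LinearOrder.lift' orderKey orderKey_injective

instance [Finite X] : WellFoundedLT (BicommMonomial X) :=
  ⟨InvImage.wf orderKey wellFounded_lt⟩

theorem prod_lt_prod_iff {m m' : Multiset X × Multiset X} :
    prod m < prod m' ↔ exponents m < exponents m' := by
  change orderKey (prod m) < orderKey (prod m') ↔ _
  simp [orderKey, Prod.Lex.lt_iff]

theorem prod_lt_gen (m : Multiset X × Multiset X) (i : X) : prod m < gen i :=
  Prod.Lex.lt_iff.2 (Or.inl Bool.false_lt_true)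

theorem sandwich_gen_lt_sandwich_gen (a : Multiset X × Multiset X) {m : Multiset X × Multiset X}
    {j : BicommMonomial X} (hj : j < prod m) :
    IsBicommutative.sandwich gen a j < IsBicommutative.sandwich gen a (prod m) := by
  cases j with
  | gen i => exact absurd hj (prod_lt_gen m i).not_gt
  | prod m' =>
    rw [sandwich_gen_prod, sandwich_gen_prod, prod_lt_prod_iff, exponents_add, exponents_add]
    exact add_lt_add_right (prod_lt_prod_iff.1 hj) _

end Order

end BicommMonomial

section Terms

variable {n : ℕ} {σ : Type*}

/-- The step of a course-of-values recursion on the codes of terms, for a function with the values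
`g` at the letters that is compatible with products by `h`: computes the value at a term from the
list `l` of the values at all terms with smaller codes. -/
def termRecStep (g : List σ) (h : σ → σ → σ) (l : List σ) : Option σ :=
  g[l.length]? <|> (l[(l.length - g.length).unpair.1]?).bind fun u =>
    (l[(l.length - g.length).unpair.2]?).map (h u)

theorem termRecStep_map_range {f : FreeMagma (Fin (n + 1)) → σ} {h : σ → σ → σ}
    (hf : ∀ s t, f (s * t) = h (f s) (f t)) (m : ℕ) :
    termRecStep (List.ofFn fun i => f (.of i)) h
      ((List.range m).map fun m => f (termDecode n m)) = some (f (termDecode n m)) := by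
  simp only [termRecStep, List.length_map, List.length_range, List.getElem?_ofFn, List.length_ofFn]
  rw [termDecode]
  split_ifs with hm
  · rfl
  · have hleft := Nat.unpair_left_le (m - (n + 1))
    have hright := Nat.unpair_right_le (m - (n + 1))
    rw [List.getElem?_map, List.getElem?_map, List.getElem?_range (by omega),
      List.getElem?_range (by omega)]
    exact congrArg some (hf _ _).symm

variable [Primcodable σ]

theorem computable_termRecStep (g : List σ) {h : σ → σ → σ} (hh : Computable₂ h) :
    Computable (termRecStep g h) := by
  have hpair : Primrec fun l : List σ => (l.length - g.length).unpair :=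
    Primrec.unpair.comp (Primrec.nat_sub.comp .list_length (.const _))
  have hfst : Computable fun l : List σ => l[(l.length - g.length).unpair.1]? :=
    (Primrec.list_getElem?.comp .id (Primrec.fst.comp hpair)).to_comp
  have hsnd : Computable fun l : List σ => l[(l.length - g.length).unpair.2]? :=
    (Primrec.list_getElem?.comp .id (Primrec.snd.comp hpair)).to_comp
  have hmul : Computable₂ fun (l : List σ) (u : σ) =>
      (l[(l.length - g.length).unpair.2]?).map (h u) :=
    Computable.option_map (hsnd.comp .fst) (hh.comp (.comp .snd .fst) .snd)
  exact Primrec.option_orElse.to_comp.comp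
    (Primrec.list_getElem?.comp (.const g) .list_length).to_comp (Computable.option_bind hfst hmul)

theorem computable_of_forall_mul {f : FreeMagma (Fin n) → σ} {h : σ → σ → σ} (hh : Computable₂ h)
    (hf : ∀ s t, f (s * t) = h (f s) (f t)) : Computable f := by
  cases n with
  | zero => exact Partrec.none.of_eq fun t => (term_isEmpty t).elim
  | succ n =>
    have hcode : @Primrec _ _ (termPrimcodable (n + 1)) _ (termEquiv n) :=
      Primrec.of_equiv (e := termEquiv n)
    have hdecode : Computable₂ fun (_ : Unit) m => f (termDecode n m) :=
      Computable.nat_strong_rec _ (Computable.to₂ ((computable_termRecStep _ hh).comp .snd))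
        fun _ => termRecStep_map_range hf
    refine (hdecode.comp (.const ()) hcode.to_comp).of_eq fun t => ?_
    exact congrArg f (termDecode_termCode t)

end Terms

namespace BicommMonomial

variable {n : ℕ} {σ : Type*} [Primcodable σ]

/-- The decomposition of the monomials into generators and products, by which they are coded. -/
def equivSum (X : Type*) : BicommMonomial X ≃ X ⊕ (Multiset X × Multiset X) where
  toFun | gen i => .inl i | prod m => .inr m
  invFun | .inl i => gen i | .inr m => prod m
  left_inv | gen _ => rfl | prod _ => rfl
  right_inv | .inl _ => rfl | .inr _ => rfl

noncomputable instance : Primcodable (BicommMonomial (Fin n)) :=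
  Primcodable.ofEquiv _ (equivSum (Fin n))

theorem computable_prod : Computable (prod (X := Fin n)) :=
  ((Primrec.of_equiv_symm (e := equivSum (Fin n))).comp .sumInr).to_comp

theorem computable_of_computable_prod {f : BicommMonomial (Fin n) → σ}
    (hf : Computable fun m => f (prod m)) : Computable f := by
  refine (Computable.sumCasesOn (f := equivSum (Fin n)) (g := fun _ i => f (gen i))
    (h := fun _ m => f (prod m)) (Primrec.of_equiv (e := equivSum (Fin n))).to_comp
    ((Primrec.dom_finite fun i => f (gen i)).to_comp.comp .snd) (hf.comp .snd)).of_eq ?_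
  rintro (i | m) <;> rfl

theorem computablePred_of_computablePred_prod {p : BicommMonomial (Fin n) → Prop}
    (hp : ComputablePred fun m => p (prod m)) : ComputablePred p := by
  classical exact (computable_of_computable_prod hp.decide).computablePred

theorem computable_mul : Computable₂ fun s t : BicommMonomial (Fin n) => s * t := by
  have hadd : Primrec₂ fun m m' : Multiset (Fin n) × Multiset (Fin n) => m + m' :=
    Primrec.pair (primrec_multiset_add.comp (Primrec.fst.comp .fst) (Primrec.fst.comp .snd))
      (primrec_multiset_add.comp (Primrec.snd.comp .fst) (Primrec.snd.comp .snd))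
  have hleft : Computable (asLeft (X := Fin n)) := computable_of_computable_prod .id
  have hright : Computable (asRight (X := Fin n)) := computable_of_computable_prod .id
  exact computable_prod.comp (hadd.to_comp.comp (hleft.comp .fst) (hright.comp .snd))

theorem computable_ofWord : Computable (ofWord (X := Fin n)) :=
  computable_of_forall_mul computable_mul (map_mul ofWord)

theorem computable_gen : Computable (gen (X := Fin n)) :=
  (Primrec.dom_finite gen).to_comp

open IsBicommutative

theorem computable_mulRight_gen :
    Computable₂ fun (b : List (Fin n)) u => mulRight gen (b : Multiset (Fin n)) u :=
  computable_list_foldl (f := fun q : List (Fin n) × BicommMonomial (Fin n) => q.1)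
    (h := fun _ p => p.1 * gen p.2) .fst .snd
    (computable_mul.comp (.comp .fst .snd) (computable_gen.comp (.comp .snd .snd)))

theorem computable_mulLeft_gen :
    Computable₂ fun (a : List (Fin n)) u => mulLeft gen (a : Multiset (Fin n)) u :=
  computable_list_foldl (f := fun q : List (Fin n) × BicommMonomial (Fin n) => q.1)
    (h := fun _ p => gen p.2 * p.1) .fst .snd
    (computable_mul.comp (computable_gen.comp (.comp .snd .snd)) (.comp .fst .snd))

end BicommMonomial

namespace BicommMonomial

open IsBicommutative

variable {R X : Type*} [Semiring R]

/-- A space of formal linear combinations of monomials that absorbs products with the generators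
on either side. -/
def IsGenStable (J : Submodule R (BicommMonomial X →₀ R)) : Prop :=
  ∀ f ∈ J, ∀ i, Finsupp.mapDomain (gen i * ·) f ∈ J ∧ Finsupp.mapDomain (· * gen i) f ∈ J

theorem IsGenStable.mapDomain_sandwich_mem {J : Submodule R (BicommMonomial X →₀ R)}
    (hJ : IsGenStable J) (a : Multiset X × Multiset X) {f : BicommMonomial X →₀ R} (hf : f ∈ J) :
    Finsupp.mapDomain (sandwich gen a) f ∈ J := by
  have mapDomain_foldl_mem : ∀ (act : BicommMonomial X → X → BicommMonomial X)
      [RightCommutative act], (∀ f ∈ J, ∀ i, Finsupp.mapDomain (act · i) f ∈ J) →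
      ∀ (b : Multiset X), ∀ f ∈ J, Finsupp.mapDomain (fun u => b.foldl act u) f ∈ J := by
    intro act _ hact b
    induction b using Multiset.induction with
    | empty => exact fun f hf => (Finsupp.mapDomain_id (v := f)).symm ▸ hf
    | cons i b ih =>
      intro f hf
      simp only [Multiset.foldl_cons]
      have hfoldl := ih _ (hact f hf i)
      rwa [← Finsupp.mapDomain_comp] at hfoldl
  have hright := mapDomain_foldl_mem (fun u i => u * gen i) (fun f hf i => (hJ f hf i).2) a.2 f hf
  have hleft :=
    mapDomain_foldl_mem (fun u i => gen i * u) (fun f hf i => (hJ f hf i).1) a.1 _ hright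
  rwa [← Finsupp.mapDomain_comp] at hleft

section GroebnerBasis

variable [LinearOrder X]

theorem isMonicAt_mapDomain_sandwich_gen {f : BicommMonomial X →₀ R} {m : Multiset X × Multiset X}
    (hf : IsMonicAt f (prod m)) (a : Multiset X × Multiset X) :
    IsMonicAt (Finsupp.mapDomain (sandwich gen a) f) (prod (a + m)) := by
  rw [← sandwich_gen_prod]
  exact hf.mapDomain fun j => sandwich_gen_lt_sandwich_gen a

variable {J : Submodule R (BicommMonomial X →₀ R)}

theorem IsGenStable.isUpperSet_prod_mem_leadIndices (hJ : IsGenStable J) :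
    IsUpperSet {m | prod m ∈ leadIndices J} := by
  rintro m m' hmm' ⟨f, hf, hfm⟩
  obtain ⟨a, rfl⟩ := le_iff_exists_add'.1 hmm'
  exact ⟨_, hJ.mapDomain_sandwich_mem a hf, isMonicAt_mapDomain_sandwich_gen hfm a⟩

theorem IsGenStable.exists_finite_isMonicAt_mapDomain_sandwich [Finite X]
    (hJ : IsGenStable J) :
    ∃ G : Set (BicommMonomial X →₀ R), G.Finite ∧ G ⊆ J ∧ ∀ i ∈ leadIndices J,
      ∃ g ∈ G, ∃ a, IsMonicAt (Finsupp.mapDomain (sandwich gen a) g) i := by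
  obtain ⟨s, hs⟩ := exists_finset_forall_mem_iff_of_isUpperSet hJ.isUpperSet_prod_mem_leadIndices
  have hfin : (leadIndices J ∩ (prod '' s ∪ Set.range gen)).Finite :=
    ((s.finite_toSet.image prod).union (Set.finite_range gen)).inter_of_right _
  choose! g hgJ hg using fun i (hi : i ∈ leadIndices J) => hi
  refine ⟨g '' (leadIndices J ∩ (prod '' s ∪ Set.range gen)), hfin.image g,
    Set.image_subset_iff.2 fun i hi => hgJ i hi.1, fun i hi => ?_⟩
  cases i with
  | gen i =>
    refine ⟨_, ⟨gen i, ⟨hi, .inr ⟨i, rfl⟩⟩, rfl⟩, 0, ?_⟩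
    exact (Finsupp.mapDomain_id (v := g (gen i))).symm ▸ hg _ hi
  | prod m' =>
    obtain ⟨m, hm, hmm'⟩ := (hs m').1 hi
    have hm_lead : prod m ∈ leadIndices J := (hs m).2 ⟨m, hm, le_rfl⟩
    obtain ⟨a, rfl⟩ := le_iff_exists_add'.1 hmm'
    refine ⟨_, ⟨prod m, ⟨hm_lead, .inl ⟨m, hm, rfl⟩⟩, rfl⟩, a, ?_⟩
    exact isMonicAt_mapDomain_sandwich_gen (hg _ hm_lead) a

end GroebnerBasis

variable {F : Type*} [Field F] {n : ℕ} {J : Submodule F (BicommMonomial (Fin n) →₀ F)}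

theorem IsGenStable.computablePred_mem_leadIndices (hJ : IsGenStable J) :
    ComputablePred (· ∈ leadIndices J) := by
  refine computablePred_of_computablePred_prod (computablePred_mem_of_isUpperSet ?_
    hJ.isUpperSet_prod_mem_leadIndices)
  have primrecRel_le : PrimrecRel fun m m' : Multiset (Fin n) × Multiset (Fin n) =>
      m.1 ≤ m'.1 ∧ m.2 ≤ m'.2 :=
    .and (primrecRel_multiset_le.comp (.comp .fst .fst) (.comp .fst .snd))
      (primrecRel_multiset_le.comp (.comp .snd .fst) (.comp .snd .snd))
  exact primrecRel_le

theorem IsGenStable.computablePred_listSum_mem [Primcodable F] (hJ : IsGenStable J)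
    (hF : IsComputableField F) :
    ComputablePred fun w : List (F × BicommMonomial (Fin n)) => listSum w ∈ J := by
  obtain ⟨G, hGfin, hGJ, hG⟩ := hJ.exists_finite_isMonicAt_mapDomain_sandwich
  obtain ⟨r, g, -, rfl⟩ := hGfin.fin_param
  choose l hl using fun k => listSum_surjective (g k)
  let multiple (q : Fin r × List (Fin n) × List (Fin n)) : List (F × BicommMonomial (Fin n)) :=
    (l q.1).map fun e => (e.1, sandwich gen (↑q.2.1, ↑q.2.2) e.2)
  have hmultiple : ∀ q, listSum (multiple q) =
      Finsupp.mapDomain (sandwich gen (↑q.2.1, ↑q.2.2)) (g q.1) := fun q => by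
    rw [listSum_map, hl]
  refine computablePred_listSum_mem_of_leadIndices hF hJ.computablePred_mem_leadIndices
    (v := multiple) ?_ (fun q => ?_) fun i hi => ?_
  · refine computable_list_map ((Primrec.dom_finite l).to_comp.comp .fst)
      (g := fun (q : Fin r × List (Fin n) × List (Fin n)) e =>
        (e.1, sandwich gen (↑q.2.1, ↑q.2.2) e.2)) (.pair (.comp .fst .snd) ?_)
    exact computable_mulLeft_gen.comp (.comp .fst (.comp .snd .fst))
      (computable_mulRight_gen.comp (.comp .snd (.comp .snd .fst)) (.comp .snd .snd))
  · rw [hmultiple]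
    exact hJ.mapDomain_sandwich_mem _ (hGJ (Set.mem_range_self _))
  · obtain ⟨_, ⟨k, rfl⟩, ⟨a, b⟩, hkab⟩ := hG i hi
    obtain ⟨a, rfl⟩ := Quot.exists_rep a
    obtain ⟨b, rfl⟩ := Quot.exists_rep b
    exact ⟨(k, a, b), (hmultiple (k, a, b)).symm ▸ hkab⟩

end BicommMonomial

namespace BicommMonomial

section RelationSpace

variable {R A X : Type*} [Semiring R] [NonUnitalNonAssocSemiring A] [Module R A]

variable (R) in
/-- The linear relations over `R` between the values of nonassociative words at `x`, written in
terms of the monomials of the words. -/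
noncomputable def relationSpace (x : X → A) : Submodule R (BicommMonomial X →₀ R) :=
  (LinearMap.ker (Finsupp.linearCombination R (FreeMagma.lift x : FreeMagma X → A))).map
    (Finsupp.lmapDomain R R ofWord)

theorem mapDomain_ofWord_mem_relationSpace_iff [IsBicommutative A] {x : X → A}
    {w : FreeMagma X →₀ R} : Finsupp.mapDomain ofWord w ∈ relationSpace R x ↔
      Finsupp.linearCombination R (FreeMagma.lift x : FreeMagma X → A) w = 0 := by
  refine ⟨fun ⟨w', hw', hww'⟩ => ?_, fun hw => ⟨w, hw, rfl⟩⟩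
  have hfactors : Function.FactorsThrough (FreeMagma.lift x : FreeMagma X → A) ofWord :=
    fun _ _ h => lift_eq_of_ofWord_eq x h
  have hlift : ∀ w, Finsupp.linearCombination R (FreeMagma.lift x : FreeMagma X → A) w =
      Finsupp.linearCombination R (Function.extend ofWord (FreeMagma.lift x) 0)
        (Finsupp.mapDomain ofWord w) := fun w => by
    rw [Finsupp.linearCombination_mapDomain, hfactors.extend_comp]
  rw [hlift, ← hww', Finsupp.lmapDomain_apply, ← hlift]
  exact hw'

theorem linearCombination_mapDomain_mul_left [SMulCommClass R A A] {M : Type*} [Mul M]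
    (φ : M →ₙ* A) (s : M) (w : M →₀ R) :
    Finsupp.linearCombination R φ (Finsupp.mapDomain (s * ·) w) =
      φ s * Finsupp.linearCombination R φ w := by
  induction w using Finsupp.induction_linear with
  | zero => simp
  | add w w' hw hw' => rw [Finsupp.mapDomain_add, map_add, map_add, hw, hw', mul_add]
  | single t c => simp [mul_smul_comm]

theorem linearCombination_mapDomain_mul_right [IsScalarTower R A A] {M : Type*} [Mul M]
    (φ : M →ₙ* A) (s : M) (w : M →₀ R) :
    Finsupp.linearCombination R φ (Finsupp.mapDomain (· * s) w) =
      Finsupp.linearCombination R φ w * φ s := by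
  induction w using Finsupp.induction_linear with
  | zero => simp
  | add w w' hw hw' => rw [Finsupp.mapDomain_add, map_add, map_add, hw, hw', add_mul]
  | single t c => simp [smul_mul_assoc]

theorem isGenStable_relationSpace [IsScalarTower R A A] [SMulCommClass R A A] (x : X → A) :
    IsGenStable (relationSpace R x) := by
  rintro _ ⟨w, hw, rfl⟩ i
  rw [SetLike.mem_coe, LinearMap.mem_ker] at hw
  have hleft : (gen i * ·) ∘ ofWord = ofWord ∘ (FreeMagma.of i * ·) := rfl
  have hright : (· * gen i) ∘ ofWord = ofWord ∘ (· * FreeMagma.of i) := rfl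
  rw [Finsupp.lmapDomain_apply, ← Finsupp.mapDomain_comp, ← Finsupp.mapDomain_comp, hleft, hright,
    Finsupp.mapDomain_comp, Finsupp.mapDomain_comp]
  refine ⟨Submodule.mem_map_of_mem (LinearMap.mem_ker.2 ?_),
    Submodule.mem_map_of_mem (LinearMap.mem_ker.2 ?_)⟩
  · rw [linearCombination_mapDomain_mul_left, hw, mul_zero]
  · rw [linearCombination_mapDomain_mul_right, hw, zero_mul]

end RelationSpace

end BicommMonomial

section WordProblem

open BicommMonomial

variable {F : Type*} [Field F] {n : ℕ}

theorem computablePred_linearCombination_lift_eq_zero [Primcodable F] (hF : IsComputableField F)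
    {A : Type*} [NonUnitalNonAssocRing A] [Module F A] [IsScalarTower F A A] [SMulCommClass F A A]
    [IsBicommutative A] (x : Fin n → A) :
    ComputablePred fun w : LinWord F n =>
      Finsupp.linearCombination F (FreeMagma.lift x) (listSum w) = 0 := by
  have hmonomials : Computable fun w : LinWord F n => w.map fun e => (e.1, ofWord e.2) :=
    computable_list_map (f := fun w : LinWord F n => w) (g := fun _ e => (e.1, ofWord e.2)) .id
      (.pair (.comp .fst .snd) (computable_ofWord.comp (.comp .snd .snd)))
  refine (computablePred_comp ((isGenStable_relationSpace x).computablePred_listSum_mem hF)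
    hmonomials).of_eq fun w => ?_
  rw [listSum_map, mapDomain_ofWord_mem_relationSpace_iff]

theorem LinWord.eval_eq_linearCombination {k : Type*} [Field k] [Algebra F k] {B : Type*}
    [NonUnitalNonAssocRing B] [Module k B] [Module F B] [IsScalarTower F k B] (x : Fin n → B)
    (w : LinWord F n) :
    w.eval k x = Finsupp.linearCombination F (FreeMagma.lift x) (listSum w) := by
  simp only [linearCombination_listSum, LinWord.eval, algebraMap_smul]

theorem mainTheorem6_general [Primcodable F] (hF : IsComputableField F) (k : Type*) [Field k]
    [Algebra F k] {B : Type*} [NonUnitalNonAssocRing B] [Module k B] [IsScalarTower k B B]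
    [SMulCommClass k B B] [IsBicommutative B] (x : Fin n → B) :
    ComputablePred fun p : LinWord F n × LinWord F n => p.1.eval k x = p.2.eval k x := by
  let _ : Module F B := Module.compHom B (algebraMap F k)
  have : IsScalarTower F k B := .of_algebraMap_smul fun _ _ => rfl
  have : IsScalarTower F B B := ⟨fun a => smul_mul_assoc (algebraMap F k a)⟩
  have : SMulCommClass F B B := ⟨fun a u v => (mul_smul_comm (algebraMap F k a) u v).symm⟩
  have hdiff : Computable fun p : LinWord F n × LinWord F n =>
      p.1 ++ p.2.map fun e => (-1 * e.1, e.2) :=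
    Computable.list_append.comp .fst (computable_list_map
      (f := fun p : LinWord F n × LinWord F n => p.2) (g := fun _ e => (-1 * e.1, e.2)) .snd
      (.pair (hF.mul.comp (.const (-1)) (.comp .fst .snd)) (.comp .snd .snd)))
  refine (computablePred_comp (computablePred_linearCombination_lift_eq_zero hF x) hdiff).of_eq
    fun p => ?_
  rw [listSum_append, listSum_map_mul, map_add, map_smul, neg_one_smul, ← sub_eq_add_neg,
    sub_eq_zero, LinWord.eval_eq_linearCombination, LinWord.eval_eq_linearCombination]

end WordProblem

/-- Over an arbitrary field `k`, every finitely presented bicommutative algebra has a solvable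
word problem, for words with coefficients in any computable subfield `F` of `k` (in particular in
`k` itself when `k` is computable, and in the prime field for arbitrary `k`). -/
theorem mainTheorem6 (F : Type*) [Field F] [Primcodable F] (hF : IsComputableField F)
    (k : Type*) [Field k] [Algebra F k] (n : ℕ)
    (S : Set (FreeBicomm k (Fin n))) (hS : S.Finite) :
    WordProblemSolvable F S :=
  mainTheorem6_general hF k (PresentedBicomm.of S)
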